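/- **Setting.** Let $\mathbf x_1,\dots,\mathbf x_n\in\mathbb R^d$ be fixed design vectors, and let $\mathbf y_1,\dots,\mathbf y_n$ be independent real random variables such that, for some $\sigma\ge 0$, $\mathbf E\,e^{t(\mathbf y_i-\mathbf E\mathbf y_i)}\le e^{\sigma^2t^2/2}$ for all $i$ and all $t\in\mathbb R$. Let $\hat A=\frac1n\sum_{i=1}^n\mathbf x_i\mathbf x_i^T$, assume that $\hat A_{j,j}=1$ for all $j$, and put $M_{\hat A}=\sup_{i\ne j}|\hat A_{i,j}|$ (with the value $0$ if $d\le 1$). **Notation.** For $\beta\in\mathbb R^d$ and $c\ge 0$ let $\mathrm{supp}_c(\beta)=\{j:|\beta_j|>c\}$. If $|\beta_{(1)}|\ge\dots\ge|\beta_{(d)}|$ are the absolute values of the components of $\beta$ in descending order, let $r_k^{(2)}(\beta)=\bigl(\sum_{j=k+1}^d|\beta_{(j)}|^2\bigr)^{1/2}$. **Two-stage procedure** with parameters $\lambda,\alpha$. Stage 1: let $$\hat\beta\in\arg\min_{\beta\in\mathbb R^d}\Bigl[\frac1n\sum_{i=1}^n(\beta^T\mathbf x_i-\mathbf y_i)^2+\lambda\sum_{j=1}^d|\beta_j|\Bigr].$$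 Stage 2: let $$\hat\beta'\in\arg\min_{\beta\in\mathbb R^d}\Bigl[\frac1n\sum_{i=1}^n(\beta^T\mathbf x_i-\mathbf y_i)^2+\lambda\sum_{j\notin\mathrm{supp}_\alpha(\hat\beta)}|\beta_j|\Bigr].$$ **Corollary 8.1.** Let $\bar\beta\in\mathbb R^d$ satisfy $\mathbf E\mathbf y_i=\bar\beta^T\mathbf x_i$ for all $i$ and have at most $s$ nonzero components, where $s\le d/3$ and $M_{\hat A}\,s\le 1/6$. Let $\delta\in(0,1/2)$, and let $\lambda>0$ and $\alpha$ be such that $$\frac{\alpha}{48}\ \ge\ \lambda\ \ge\ 12\,\sigma\sqrt{\frac{2\ln(2d/\delta)}{n}}.$$ Let $k=|\mathrm{supp}_\lambda(\bar\beta)|$ and $q=|\mathrm{supp}_{1.5\alpha}(\bar\beta)|$. Then, with probability larger than $1-2\delta$, every output $\hat\beta'$ of the two-stage procedure satisfies $$\|\hat\beta'-\bar\beta\|_2\ \le\ 24\sqrt{k-q}\,\lambda+24\,\sigma\Bigl(1+\sqrt{\tfrac{20q}{n}\ln(1/\delta)}\Bigr)+168\,r_k^{(2)}(\bar\beta).$$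 -/

import Mathlib

open MeasureTheory ProbabilityTheory
open scoped NNReal

noncomputable section

namespace TwoStageLasso

/-- The normalized Gram matrix `(1/n) ∑ᵢ xᵢ xᵢᵀ` of the design vectors. -/
def gram {n d : ℕ} (x : Fin n → EuclideanSpace ℝ (Fin d)) : Matrix (Fin d) (Fin d) ℝ :=
  Matrix.of fun j l => (1 / (n : ℝ)) * ∑ i, x i j * x i l

/-- The mutual coherence coefficient `sup_{i ≠ j} |A i j|`, a supremum over a finite set of pairs
(and `0` if there are no such pairs). -/
def coherence {d : ℕ} (A : Matrix (Fin d) (Fin d) ℝ) : ℝ :=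
  ⨆ e : {e : Fin d × Fin d // e.1 ≠ e.2}, |A e.1.1 e.1.2|

/-- The set of relevant features with threshold `α`, `supp_α(β) = {j : |β_j| > α}`. -/
def supp {d : ℕ} (α : ℝ) (β : EuclideanSpace ℝ (Fin d)) : Finset (Fin d) :=
  Finset.univ.filter fun j => α < |β j|

/-- A permutation `π` of the coordinates with `|β_{π 0}| ≥ |β_{π 1}| ≥ …`. -/
def descendingOrder {d : ℕ} (β : EuclideanSpace ℝ (Fin d)) : Equiv.Perm (Fin d) :=
  Tuple.sort fun j => -|β j|

/-- `r_k^{(p)}(β)`, for `1 ≤ p < ∞`: the `p`-norm of the `d - k` smallest components of `β` in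
absolute value (positions are counted from `0`, so the `k` largest components are those at the
positions `0, …, k - 1`). -/
def tailNorm {d : ℕ} (p : ℝ) (k : ℕ) (β : EuclideanSpace ℝ (Fin d)) : ℝ :=
  (∑ j ∈ Finset.univ.filter (fun j : Fin d => k ≤ (j : ℕ)), |β (descendingOrder β j)| ^ p) ^ (1 / p)

/-- The least squares objective in which all coordinates outside `F` carry an `L₁` penalty:
`(1/n) ∑ᵢ (βᵀ xᵢ - yᵢ)² + lam ∑_{j ∉ F} |β_j|`. -/
def objective {n d : ℕ} (x : Fin n → EuclideanSpace ℝ (Fin d)) (y : Fin n → ℝ) (lam : ℝ)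
    (F : Finset (Fin d)) (β : EuclideanSpace ℝ (Fin d)) : ℝ :=
  (1 / (n : ℝ)) * ∑ i, (inner ℝ β (x i) - y i) ^ 2 + lam * ∑ j ∈ Fᶜ, |β j|

/-- `b` is a solution of the (standard) Lasso problem: all coordinates are penalized. -/
def IsLasso {n d : ℕ} (x : Fin n → EuclideanSpace ℝ (Fin d)) (y : Fin n → ℝ) (lam : ℝ)
    (b : EuclideanSpace ℝ (Fin d)) : Prop :=
  ∀ β, objective x y lam ∅ b ≤ objective x y lam ∅ β

/-- `b'` is an output of the two-stage procedure with selective penalization with parameters `lam`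
and `α`: stage 1 computes a Lasso solution `b`, and stage 2 computes a minimizer `b'` of the
objective in which the coordinates in `supp_α(b)` are not penalized. -/
def IsTwoStage {n d : ℕ} (x : Fin n → EuclideanSpace ℝ (Fin d)) (y : Fin n → ℝ) (lam α : ℝ)
    (b' : EuclideanSpace ℝ (Fin d)) : Prop :=
  ∃ b, IsLasso x y lam b ∧
    ∀ β, objective x y lam (supp α b) b' ≤ objective x y lam (supp α b) β

end TwoStageLasso

end

/-! ### Optimality in one coordinate, and the noise scores. -/

namespace TwoStageLasso

/-! Write `A` for the Gram matrix, `M` for its coherence, `z` for the vector of scores of the true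
parameter, `v` for the error of a minimizer, and `S ⊇ K ⊇ Q` for the supports of the true parameter
at levels `0`, `lam`, `1.5 * α`. Suppose first that every `|z j| ≤ lam / 12`.

Optimality says that `A v - z` vanishes at unpenalized coordinates and is at most `lam / 2`
elsewhere, with sign opposite to the estimate. As `A` is the identity up to entries of size `M`, `A
v` differs from `v` by at most `M ‖v‖₁`, and a cone argument gives `M ‖v‖₁ ≤ 7/18 lam`
(`coherence_mul_sum_abs_error_le`). Hence errors are at most `lam` in sup norm (`abs_error_le`), and
penalized coordinates only shrink towards `0` (`abs_error_le_abs`), so `v` lives on `S`.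

Applied to the first stage, this places the selected set between `Q` and `K`. In the second stage
`Q` is then unpenalized: there `v` equals `z` up to a coherence term that `‖v‖` absorbs. On `K \ Q`
the sup-norm bound applies, and off `K` shrinkage leaves the tail of the true parameter
(`norm_error_le_of_isTwoStage`).

Two events remain: a union bound controls all scores, and a Gaussian decoupling argument controls `∑
z j ^ 2` over `Q`, since `A` is nearly isometric on vectors supported there. Each fails with
probability at most `δ`, the second strictly less. -/

/-- First order conditions for a penalized parabola minimized at displacement `0`. -/
theorem abs_le_and_mul_eq_of_penalized_min {G b lam : ℝ}
    (h : ∀ t : ℝ, 0 ≤ t ^ 2 + 2 * t * G + lam * (|b + t| - |b|)) (hlam : 0 < lam) :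
    |G| ≤ lam / 2 ∧ G * b = -(lam / 2) * |b| := by
  have h1 : ∀ t : ℝ, 0 ≤ t ^ 2 + 2 * t * G + lam * |t| := fun t => by
    have := abs_add_le b t
    nlinarith [h t]
  have hG : |G| ≤ lam / 2 := by
    rw [abs_le]
    constructor
    · by_contra! hlt
      -- The minimizer of the upper bound on this side of `0`; the value there is negative.
      have := h1 (-(G + lam / 2))
      rw [abs_of_pos (by linarith)] at this
      nlinarith
    · by_contra! hlt
      have := h1 (-(G - lam / 2))
      rw [abs_of_neg (by linarith)] at this
      nlinarith
  refine ⟨hG, ?_⟩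
  have hge : -(lam / 2) * |b| ≤ G * b := by
    have h2 : |G * b| ≤ lam / 2 * |b| := by
      rw [abs_mul]
      gcongr
    linarith [neg_abs_le (G * b)]
  have key : ∀ θ : ℝ, 0 < θ → θ ≤ 1 → 2 * b * G + lam * |b| ≤ θ * b ^ 2 := by
    intro θ h0 h1'
    have h3 := h (-θ * b)
    have h4 : |b + -θ * b| = (1 - θ) * |b| := by
      rw [show b + -θ * b = (1 - θ) * b by ring, abs_mul, abs_of_nonneg (by linarith)]
    rw [h4] at h3
    have h5 : 0 ≤ θ * (θ * b ^ 2 - (2 * b * G + lam * |b|)) := by linarith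
    have := nonneg_of_mul_nonneg_right h5 h0
    linarith
  by_contra hne
  have hX : 0 < 2 * b * G + lam * |b| := by
    rcases lt_or_eq_of_le hge with h6 | h6
    · linarith
    · exact absurd h6.symm hne
  have hb2 := key 1 one_pos le_rfl
  have hb : 0 < b ^ 2 := by linarith
  -- This `θ` makes the right side of `key` half of its positive left side; `θ ≤ 1` follows from the
  -- case `θ = 1`.
  have h7 := key ((2 * b * G + lam * |b|) / (2 * b ^ 2)) (by positivity)
    (by rw [div_le_one (by positivity)]; linarith)
  have h8 : (2 * b * G + lam * |b|) / (2 * b ^ 2) * b ^ 2 = (2 * b * G + lam * |b|) / 2 := by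
    rw [div_mul_eq_mul_div, mul_comm 2 (b ^ 2), ← div_div, mul_div_assoc, div_self hb.ne', mul_one]
  linarith

/-- The correlation `(1/n) ∑ᵢ xᵢⱼ (yᵢ - βᵀ xᵢ)` of the `j`-th feature with the noise. -/
noncomputable def score {n d : ℕ} (x : Fin n → EuclideanSpace ℝ (Fin d)) (y : Fin n → ℝ)
    (β : EuclideanSpace ℝ (Fin d)) (j : Fin d) : ℝ :=
  (1 / (n : ℝ)) * ∑ i, x i j * (y i - inner ℝ β (x i))

/-! ### Coherence bounds for the Gram matrix. -/

section Deterministic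

variable {n d : ℕ} {x : Fin n → EuclideanSpace ℝ (Fin d)}

theorem sum_gram_mul (v : EuclideanSpace ℝ (Fin d)) (j : Fin d) :
    ∑ l, gram x j l * v l = (1 / (n : ℝ)) * ∑ i, x i j * inner ℝ v (x i) := by
  simp only [gram, Matrix.of_apply, PiLp.inner_apply, RCLike.inner_apply, conj_trivial,
    Finset.mul_sum, Finset.sum_mul]
  rw [Finset.sum_comm]
  refine Finset.sum_congr rfl fun i _ => Finset.sum_congr rfl fun l _ => ?_
  ring

theorem sum_gram_quadratic (v : EuclideanSpace ℝ (Fin d)) :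
    ∑ j, (∑ l, gram x j l * v l) * v j = (1 / (n : ℝ)) * ∑ i, (inner ℝ v (x i)) ^ 2 := by
  simp only [sum_gram_mul, Finset.mul_sum, Finset.sum_mul]
  rw [Finset.sum_comm]
  refine Finset.sum_congr rfl fun i _ => ?_
  have h : (inner ℝ v (x i) : ℝ) = ∑ j, x i j * v j := by
    simp [PiLp.inner_apply]
  calc _ = (1 / (n : ℝ)) * inner ℝ v (x i) * ∑ j, x i j * v j := by
          rw [Finset.mul_sum]
          exact Finset.sum_congr rfl fun j _ => by ring
    _ = _ := by rw [← h]; ring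

theorem sum_gram_quadratic_nonneg (v : EuclideanSpace ℝ (Fin d)) :
    0 ≤ ∑ j, (∑ l, gram x j l * v l) * v j := by
  rw [sum_gram_quadratic]
  positivity

theorem abs_gram_le_coherence {j l : Fin d} (h : j ≠ l) :
    |gram x j l| ≤ coherence (gram x) :=
  le_ciSup (f := fun e : {e : Fin d × Fin d // e.1 ≠ e.2} => |gram x e.1.1 e.1.2|)
    (Set.finite_range _).bddAbove ⟨(j, l), h⟩

theorem coherence_nonneg (A : Matrix (Fin d) (Fin d) ℝ) : 0 ≤ coherence A :=
  Real.iSup_nonneg fun _ => abs_nonneg _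

/-- The off-diagonal part of `A v` is bounded by the coherence times the `ℓ₁` norm of `v`. -/
theorem abs_sum_gram_mul_sub_le (hA : ∀ j, gram x j j = 1) (v : EuclideanSpace ℝ (Fin d))
    (j : Fin d) : |∑ l, gram x j l * v l - v j| ≤ coherence (gram x) * ∑ l, |v l| := by
  have h : ∑ l, gram x j l * v l - v j = ∑ l ∈ Finset.univ.erase j, gram x j l * v l := by
    rw [← Finset.add_sum_erase _ _ (Finset.mem_univ j), hA]
    ring
  rw [h]
  calc _ ≤ ∑ l ∈ Finset.univ.erase j, |gram x j l * v l| := Finset.abs_sum_le_sum_abs _ _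
    _ ≤ ∑ l ∈ Finset.univ.erase j, coherence (gram x) * |v l| := by
        refine Finset.sum_le_sum fun l hl => ?_
        rw [abs_mul]
        gcongr
        exact abs_gram_le_coherence (Finset.ne_of_mem_erase hl).symm
    _ ≤ ∑ l, coherence (gram x) * |v l| :=
        Finset.sum_le_sum_of_subset_of_nonneg (Finset.subset_univ _)
          fun l _ _ => mul_nonneg (coherence_nonneg _) (abs_nonneg _)
    _ = _ := by rw [Finset.mul_sum]

/-- Sparse upper eigenvalue bound from the coherence. -/
theorem sum_inner_sq_le_of_sparse (hA : ∀ j, gram x j j = 1) {Q : Finset (Fin d)}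
    (hM : coherence (gram x) * (Q.card : ℝ) ≤ 1 / 6) (v : EuclideanSpace ℝ (Fin d))
    (hv : ∀ j ∉ Q, v j = 0) :
    (1 / (n : ℝ)) * ∑ i, (inner ℝ v (x i)) ^ 2 ≤ 7 / 6 * ∑ j, v j ^ 2 := by
  rw [← sum_gram_quadratic]
  set M := coherence (gram x)
  have hM0 : 0 ≤ M := coherence_nonneg _
  have h1 : ∀ j, (∑ l, gram x j l * v l) * v j ≤ v j ^ 2 + M * (∑ l, |v l|) * |v j| := fun j => by
    have h2 : (∑ l, gram x j l * v l - v j) * v j ≤ M * (∑ l, |v l|) * |v j| := by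
      refine (le_abs_self _).trans ?_
      rw [abs_mul]
      gcongr
      exact abs_sum_gram_mul_sub_le hA v j
    linarith
  have h3 : (∑ l, |v l|) ^ 2 ≤ Q.card * ∑ l, v l ^ 2 := by
    have h4 : ∑ l, |v l| = ∑ l ∈ Q, |v l| := by
      refine (Finset.sum_subset (Finset.subset_univ Q) fun l _ hl => ?_).symm
      rw [hv l hl, abs_zero]
    rw [h4]
    refine sq_sum_le_card_mul_sum_sq.trans ?_
    gcongr
    simp only [sq_abs]
    exact Finset.sum_le_sum_of_subset_of_nonneg (Finset.subset_univ Q) fun _ _ _ => sq_nonneg _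
  calc _ ≤ ∑ j, (v j ^ 2 + M * (∑ l, |v l|) * |v j|) := Finset.sum_le_sum fun j _ => h1 j
    _ = ∑ j, v j ^ 2 + M * (∑ l, |v l|) ^ 2 := by
        rw [Finset.sum_add_distrib, ← Finset.mul_sum]
        ring
    _ ≤ ∑ j, v j ^ 2 + M * (Q.card * ∑ l, v l ^ 2) := by gcongr
    _ = ∑ j, v j ^ 2 + M * Q.card * ∑ l, v l ^ 2 := by ring
    _ ≤ ∑ j, v j ^ 2 + 1 / 6 * ∑ l, v l ^ 2 := by gcongr
    _ = _ := by ring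

/-! ### Optimality conditions for the penalized problem. -/

/-- Change of the least squares objective along a coordinate direction. -/
theorem objective_add_single_sub (hA : ∀ j, gram x j j = 1) (y : Fin n → ℝ) (lam : ℝ)
    (F : Finset (Fin d)) (b β : EuclideanSpace ℝ (Fin d)) (j : Fin d) (t : ℝ) :
    objective x y lam F (b + EuclideanSpace.single j t) - objective x y lam F b
      = t ^ 2 + 2 * t * (∑ l, gram x j l * (b - β) l - score x y β j)
        + if j ∈ F then 0 else lam * (|b j + t| - |b j|) := by
  have hpen : ∑ l ∈ Fᶜ, |(b + EuclideanSpace.single j t) l| - ∑ l ∈ Fᶜ, |b l|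
      = if j ∈ F then 0 else |b j + t| - |b j| := by
    rw [← Finset.sum_sub_distrib]
    split_ifs with hj
    · refine Finset.sum_eq_zero fun l hl => ?_
      have : l ≠ j := fun h => (Finset.mem_compl.1 hl) (h ▸ hj)
      simp [this]
    · rw [Finset.sum_eq_single_of_mem j (Finset.mem_compl.2 hj)]
      · simp
      · intro l _ hl
        simp [hl]
  have hdiag : (1 / (n : ℝ)) * ∑ i, x i j * x i j = 1 := by
    simpa [gram] using hA j
  have hgrad : ∑ l, gram x j l * (b - β) l - score x y β j
      = (1 / (n : ℝ)) * ∑ i, x i j * (inner ℝ b (x i) - y i) := by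
    rw [sum_gram_mul, score, ← mul_sub, ← Finset.sum_sub_distrib]
    congr 1
    refine Finset.sum_congr rfl fun i _ => ?_
    rw [inner_sub_left]
    ring
  have hin : ∀ i, (inner ℝ (b + EuclideanSpace.single j t) (x i) : ℝ)
      = inner ℝ b (x i) + t * x i j := fun i => by
    rw [inner_add_left, EuclideanSpace.inner_single_left]
    simp
  have hquad : ∑ i, (inner ℝ (b + EuclideanSpace.single j t) (x i) - y i) ^ 2
      - ∑ i, (inner ℝ b (x i) - y i) ^ 2
      = t ^ 2 * ∑ i, x i j * x i j + 2 * t * ∑ i, x i j * (inner ℝ b (x i) - y i) := by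
    rw [← Finset.sum_sub_distrib, Finset.mul_sum, Finset.mul_sum, ← Finset.sum_add_distrib]
    refine Finset.sum_congr rfl fun i _ => ?_
    rw [hin]
    ring
  have hite : (if j ∈ F then (0 : ℝ) else lam * (|b j + t| - |b j|))
      = lam * if j ∈ F then 0 else |b j + t| - |b j| := by
    split_ifs <;> simp
  rw [hite, ← hpen, hgrad]
  unfold objective
  linear_combination (1 / (n : ℝ)) * hquad + t ^ 2 * hdiag

section KKT

variable {y : Fin n → ℝ} {lam : ℝ} {F : Finset (Fin d)} {b : EuclideanSpace ℝ (Fin d)}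

theorem kkt_of_mem (hA : ∀ j, gram x j j = 1)
    (hb : ∀ β, objective x y lam F b ≤ objective x y lam F β) (β : EuclideanSpace ℝ (Fin d))
    {j : Fin d} (hj : j ∈ F) : ∑ l, gram x j l * (b - β) l = score x y β j := by
  set G := ∑ l, gram x j l * (b - β) l - score x y β j with hG
  -- With unit curvature, the exact line minimization changes the objective by `-G ^ 2`.
  have h := objective_add_single_sub hA y lam F b β j (-G)
  rw [if_pos hj, ← hG] at h
  have := hb (b + EuclideanSpace.single j (-G))
  have hG0 : G = 0 := by nlinarith [sq_nonneg G]
  linarith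

theorem kkt_of_notMem (hA : ∀ j, gram x j j = 1) (hlam : 0 < lam)
    (hb : ∀ β, objective x y lam F b ≤ objective x y lam F β) (β : EuclideanSpace ℝ (Fin d))
    {j : Fin d} (hj : j ∉ F) :
    |∑ l, gram x j l * (b - β) l - score x y β j| ≤ lam / 2 ∧
      (∑ l, gram x j l * (b - β) l - score x y β j) * b j = -(lam / 2) * |b j| := by
  refine abs_le_and_mul_eq_of_penalized_min (fun t => ?_) hlam
  have h := objective_add_single_sub hA y lam F b β j t
  rw [if_neg hj] at h
  linarith [hb (b + EuclideanSpace.single j t)]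

end KKT

/-! ### Sup-norm error and shrinkage. -/

/-- Sup-norm error bounds for the (selectively penalized) Lasso under mutual incoherence. -/
theorem coherence_mul_sum_abs_error_le {y : Fin n → ℝ} {lam : ℝ} {F S : Finset (Fin d)}
    {b β : EuclideanSpace ℝ (Fin d)} (hA : ∀ j, gram x j j = 1) (hlam : 0 < lam)
    (hb : ∀ β, objective x y lam F b ≤ objective x y lam F β)
    (hFS : F ⊆ S) (hβ : ∀ j ∉ S, β j = 0)
    (hM : coherence (gram x) * (S.card : ℝ) ≤ 1 / 6)
    (hz : ∀ j, |score x y β j| ≤ lam / 12) :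
    coherence (gram x) * ∑ l, |(b - β) l| ≤ 7 / 18 * lam := by
  set M := coherence (gram x)
  have hM0 : 0 ≤ M := coherence_nonneg _
  set v : EuclideanSpace ℝ (Fin d) := b - β with hv
  set a : Fin d → ℝ := fun j => ∑ l, gram x j l * v l with ha
  have hG : ∀ j, |a j - score x y β j| ≤ lam / 2 := fun j => by
    by_cases hj : j ∈ F
    · rw [ha]
      simp only
      rw [kkt_of_mem hA hb β hj, sub_self, abs_zero]
      positivity
    · exact (kkt_of_notMem hA hlam hb β hj).1
  have haj : ∀ j, |a j| ≤ 7 / 12 * lam := fun j => by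
    have h1 := abs_add_le (a j - score x y β j) (score x y β j)
    rw [sub_add_cancel] at h1
    linarith [hG j, hz j]
  set U := ∑ l ∈ S, |v l| with hU
  set V := ∑ l ∈ Sᶜ, |v l| with hV
  have hUV : ∑ l, |v l| = U + V := (Finset.sum_add_sum_compl S _).symm
  have hV0 : 0 ≤ V := Finset.sum_nonneg fun _ _ => abs_nonneg _
  have hU0 : 0 ≤ U := Finset.sum_nonneg fun _ _ => abs_nonneg _
  -- Here `0 ≤ vᵀ A v`. Off `S` the error is the estimate itself, so the penalty contributes `-(1/2
  -- - 1/12) lam |v j|`; on `S` each term is at most `(1/2 + 1/12) lam |v j|`.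
  have hcone : 5 * V ≤ 7 * U := by
    have hq : 0 ≤ ∑ j, a j * v j := sum_gram_quadratic_nonneg v
    rw [← Finset.sum_add_sum_compl S] at hq
    have h1 : ∑ j ∈ S, a j * v j ≤ 7 / 12 * lam * U := by
      rw [hU, Finset.mul_sum]
      refine Finset.sum_le_sum fun j _ => (le_abs_self _).trans ?_
      rw [abs_mul]
      gcongr
      exact haj j
    have h2 : ∑ j ∈ Sᶜ, a j * v j ≤ -(5 / 12 * lam) * V := by
      rw [hV, Finset.mul_sum]
      refine Finset.sum_le_sum fun j hj => ?_
      have hjS := Finset.mem_compl.1 hj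
      have hk := (kkt_of_notMem hA hlam hb β (fun h => hjS (hFS h))).2
      have hvj : v j = b j := by simp [hv, hβ j hjS]
      rw [← hvj] at hk
      have h3 : score x y β j * v j ≤ lam / 12 * |v j| := by
        refine (le_abs_self _).trans ?_
        rw [abs_mul]
        gcongr
        exact hz j
      have h4 : (a j - score x y β j) * v j = -(lam / 2) * |v j| := hk
      linarith
    have h5 : 0 ≤ lam * (7 * U - 5 * V) := by linarith
    have := nonneg_of_mul_nonneg_right h5 hlam
    linarith
  have hpt : ∀ j, |v j| ≤ 7 / 12 * lam + M * (12 / 5 * U) := fun j => by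
    have h1 := abs_sum_gram_mul_sub_le hA v j
    rw [hUV] at h1
    have h2 := abs_add_le (v j - a j) (a j)
    rw [sub_add_cancel, abs_sub_comm] at h2
    have h3 : M * (U + V) ≤ M * (12 / 5 * U) := mul_le_mul_of_nonneg_left (by linarith) hM0
    have h4 : |a j - v j| ≤ M * (U + V) := h1
    linarith [haj j]
  have hsum : U ≤ S.card * (7 / 12 * lam + M * (12 / 5 * U)) := by
    have := Finset.sum_le_card_nsmul S (fun l => |v l|) _ fun j _ => hpt j
    rwa [nsmul_eq_mul] at this
  -- Self-bounding: with `M * S.card ≤ 1 / 6` it yields `M * U ≤ 35/216 lam`, and `12/5` times this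
  -- is `7/18 lam`.
  have hMU : M * U ≤ M * S.card * (7 / 12 * lam + 12 / 5 * (M * U)) := by
    calc M * U ≤ M * (S.card * (7 / 12 * lam + M * (12 / 5 * U))) := by gcongr
      _ = _ := by ring
  have h6 : M * S.card * (7 / 12 * lam + 12 / 5 * (M * U))
      ≤ 1 / 6 * (7 / 12 * lam + 12 / 5 * (M * U)) := by
    gcongr
  rw [hUV]
  have h7 : M * (U + V) ≤ M * (12 / 5 * U) := mul_le_mul_of_nonneg_left (by linarith) hM0
  linarith

/-- Every coordinate of the error of a selectively penalized Lasso solution is at most `lam`. -/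
theorem abs_error_le {y : Fin n → ℝ} {lam : ℝ} {F S : Finset (Fin d)}
    {b β : EuclideanSpace ℝ (Fin d)} (hA : ∀ j, gram x j j = 1) (hlam : 0 < lam)
    (hb : ∀ β, objective x y lam F b ≤ objective x y lam F β)
    (hFS : F ⊆ S) (hβ : ∀ j ∉ S, β j = 0)
    (hM : coherence (gram x) * (S.card : ℝ) ≤ 1 / 6)
    (hz : ∀ j, |score x y β j| ≤ lam / 12) (j : Fin d) :
    |(b - β) j| ≤ lam := by
  have h0 := coherence_mul_sum_abs_error_le hA hlam hb hFS hβ hM hz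
  have h1 := abs_sum_gram_mul_sub_le hA (b - β) j
  have hG : |∑ l, gram x j l * (b - β) l - score x y β j| ≤ lam / 2 := by
    by_cases hj : j ∈ F
    · rw [kkt_of_mem hA hb β hj, sub_self, abs_zero]
      positivity
    · exact (kkt_of_notMem hA hlam hb β hj).1
  have hzj := hz j
  rw [abs_le] at *
  -- `7/18 + 1/2 + 1/12 = 35/36`.
  constructor <;> linarith

/-- Penalized coordinates of a selectively penalized Lasso solution shrink towards `0` without
changing sign. -/
theorem abs_error_le_abs {y : Fin n → ℝ} {lam : ℝ} {F S : Finset (Fin d)}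
    {b β : EuclideanSpace ℝ (Fin d)} (hA : ∀ j, gram x j j = 1) (hlam : 0 < lam)
    (hb : ∀ β, objective x y lam F b ≤ objective x y lam F β)
    (hFS : F ⊆ S) (hβ : ∀ j ∉ S, β j = 0)
    (hM : coherence (gram x) * (S.card : ℝ) ≤ 1 / 6)
    (hz : ∀ j, |score x y β j| ≤ lam / 12) {j : Fin d} (hj : j ∉ F) :
    |(b - β) j| ≤ |β j| := by
  have h0 := coherence_mul_sum_abs_error_le hA hlam hb hFS hβ hM hz
  have h1 := abs_le.1 (abs_sum_gram_mul_sub_le hA (b - β) j)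
  have h2 := (kkt_of_notMem hA hlam hb β hj).2
  have hzj := abs_le.1 (hz j)
  have hv : (b - β) j = b j - β j := by simp
  set G := ∑ l, gram x j l * (b - β) l
  rcases lt_trichotomy (b j) 0 with hbj | hbj | hbj
  · rw [abs_of_neg hbj] at h2
    have h3 : G - score x y β j = lam / 2 := by
      have : (G - score x y β j) * b j = lam / 2 * b j := by linarith
      exact mul_right_cancel₀ hbj.ne this
    -- The penalty dominates: `1/2 - 1/12 - 7/18 = 1/36 > 0`. So `β j < b j < 0`.
    have h4 : 0 < (b - β) j := by linarith [h1.1, h1.2]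
    rw [abs_of_pos h4, abs_of_neg (by linarith)]
    linarith
  · rw [hv, hbj, zero_sub, abs_neg]
  · rw [abs_of_pos hbj] at h2
    have h3 : G - score x y β j = -(lam / 2) := mul_right_cancel₀ hbj.ne' h2
    have h4 : (b - β) j < 0 := by linarith [h1.1, h1.2]
    rw [abs_of_neg h4, abs_of_pos (by linarith)]
    linarith

/-- If position `p` of the descending order holds an index outside the support, the whole support
sits at earlier positions, so `p` is at least its cardinality. -/
theorem sqrt_sum_compl_supp_sq_le_tailNorm (lam : ℝ) (β : EuclideanSpace ℝ (Fin d)) :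
    Real.sqrt (∑ j ∈ (supp lam β)ᶜ, (β j) ^ 2) ≤ tailNorm 2 (supp lam β).card β := by
  set π := descendingOrder β
  set k := (supp lam β).card with hk
  have hmono : ∀ p p' : Fin d, p ≤ p' → |β (π p')| ≤ |β (π p)| := fun p p' h => by
    have := Tuple.monotone_sort (fun j => -|β j|) h
    simp only [Function.comp_apply] at this
    exact neg_le_neg_iff.1 this
  have hpos : ∀ p : Fin d, π p ∉ supp lam β → k ≤ p := by
    intro p hp
    have hsub : supp lam β ⊆ (Finset.Iio p).map π.toEmbedding := by
      intro j hj
      refine Finset.mem_map.2 ⟨π.symm j, ?_, by simp⟩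
      rw [Finset.mem_Iio]
      by_contra! hle
      have h1 := hmono _ _ hle
      rw [Equiv.apply_symm_apply] at h1
      simp only [supp, Finset.mem_filter, Finset.mem_univ, true_and, not_lt] at hp hj
      linarith
    have := Finset.card_le_card hsub
    rwa [Finset.card_map, Fin.card_Iio] at this
  have hle : ∑ j ∈ (supp lam β)ᶜ, (β j) ^ 2
      ≤ ∑ j ∈ Finset.univ.filter (fun j : Fin d => k ≤ (j : ℕ)), (β (π j)) ^ 2 := by
    have hmap := Finset.sum_map (Finset.univ.filter (fun j : Fin d => k ≤ (j : ℕ))) π.toEmbedding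
      (fun j => (β j) ^ 2)
    refine le_trans (Finset.sum_le_sum_of_subset_of_nonneg (fun j hj => ?_)
      fun _ _ _ => sq_nonneg _) hmap.le
    refine Finset.mem_map.2 ⟨π.symm j, ?_, by simp⟩
    simp only [Finset.mem_filter, Finset.mem_univ, true_and]
    exact hpos _ (by simpa using hj)
  unfold tailNorm
  simp only [Real.rpow_two, sq_abs]
  rw [← Real.sqrt_eq_rpow]
  exact Real.sqrt_le_sqrt hle

end Deterministic

/-! ### Deterministic bound for the two stages. -/

theorem norm_toLp_ite {d : ℕ} (T : Finset (Fin d)) (f : Fin d → ℝ) :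
    ‖(WithLp.toLp 2 fun j => if j ∈ T then f j else 0 : EuclideanSpace ℝ (Fin d))‖
      = Real.sqrt (∑ j ∈ T, f j ^ 2) := by
  rw [EuclideanSpace.norm_eq]
  congr 1
  rw [← Finset.sum_filter_add_sum_filter_not Finset.univ (fun j => j ∈ T)]
  rw [Finset.sum_eq_zero (s := Finset.univ.filter fun j => j ∉ T)]
  · rw [add_zero, Finset.filter_mem_eq_inter, Finset.univ_inter]
    refine Finset.sum_congr rfl fun j hj => ?_
    simp [hj]
  · intro j hj
    simp [(Finset.mem_filter.1 hj).2]

/-- Splits `v` on `Q` into noise `z` and bias `v - z`, so that the bias can later be absorbed into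
`‖v‖`. -/
theorem norm_le_sum_of_subset {d : ℕ} {Q K : Finset (Fin d)} (hQK : Q ⊆ K)
    (v : EuclideanSpace ℝ (Fin d)) (z : Fin d → ℝ) :
    ‖v‖ ≤ Real.sqrt (∑ j ∈ Q, z j ^ 2) + Real.sqrt (∑ j ∈ Q, (v j - z j) ^ 2)
      + Real.sqrt (∑ j ∈ K \ Q, v j ^ 2) + Real.sqrt (∑ j ∈ Kᶜ, v j ^ 2) := by
  have hdecomp : v = (WithLp.toLp 2 fun j => if j ∈ Q then z j else 0)
      + (WithLp.toLp 2 fun j => if j ∈ Q then v j - z j else 0)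
      + (WithLp.toLp 2 fun j => if j ∈ K \ Q then v j else 0)
      + (WithLp.toLp 2 fun j => if j ∈ Kᶜ then v j else 0) := by
    ext j
    by_cases h1 : j ∈ Q
    · simp [h1, hQK h1]
    · by_cases h2 : j ∈ K <;> simp [h1, h2]
  simp only [← norm_toLp_ite]
  exact (congrArg norm hdecomp).trans_le norm_add₄_le

/-- Error bound for the two-stage procedure when all features are nearly uncorrelated with the
noise. -/
theorem norm_error_le_of_isTwoStage {n d : ℕ} {x : Fin n → EuclideanSpace ℝ (Fin d)}
    {y : Fin n → ℝ} {lam α : ℝ} {b' β : EuclideanSpace ℝ (Fin d)}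
    (hA : ∀ j, gram x j j = 1) (hlam : 0 < lam) (hα : lam ≤ α / 48)
    (hM : coherence (gram x) * ((supp 0 β).card : ℝ) ≤ 1 / 6)
    (hz : ∀ j, |score x y β j| ≤ lam / 12) (hb' : IsTwoStage x y lam α b') :
    ‖b' - β‖ ≤ 6 / 5 * (Real.sqrt (∑ j ∈ supp (1.5 * α) β, score x y β j ^ 2)
      + Real.sqrt (((supp lam β).card : ℝ) - (supp (1.5 * α) β).card) * lam
      + tailNorm 2 (supp lam β).card β) := by
  obtain ⟨b, hb, hb'⟩ := hb'
  set S := supp 0 β with hS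
  set K := supp lam β with hK
  set Q := supp (1.5 * α) β with hQ
  set F := supp α b with hF
  have hβ : ∀ j ∉ S, β j = 0 := fun j hj => by
    simpa [hS, supp] using hj
  have hQK : Q ⊆ K := fun j hj => by
    simp only [hQ, hK, supp, Finset.mem_filter, Finset.mem_univ, true_and] at hj ⊢
    linarith
  have hKS : K ⊆ S := fun j hj => by
    simp only [hS, hK, supp, Finset.mem_filter, Finset.mem_univ, true_and] at hj ⊢
    linarith
  have hstage1 : ∀ j, |b j - β j| ≤ lam := fun j =>
    abs_error_le hA hlam hb (Finset.empty_subset S) hβ hM hz j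
  have hFK : F ⊆ K := fun j hj => by
    simp only [hF, hK, supp, Finset.mem_filter, Finset.mem_univ, true_and] at hj ⊢
    have := abs_sub_abs_le_abs_sub (b j) (β j)
    linarith [hstage1 j]
  have hQF : Q ⊆ F := fun j hj => by
    simp only [hF, hQ, supp, Finset.mem_filter, Finset.mem_univ, true_and] at hj ⊢
    have := abs_sub_abs_le_abs_sub (β j) (b j)
    rw [abs_sub_comm] at this
    linarith [hstage1 j]
  have hFS := hFK.trans hKS
  set v := b' - β with hv
  set z := score x y β
  set M := coherence (gram x)
  have hM0 : 0 ≤ M := coherence_nonneg _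
  have hvj : ∀ j, |v j| ≤ lam := abs_error_le hA hlam hb' hFS hβ hM hz
  have hvK : ∀ j ∉ K, |v j| ≤ |β j| := fun j hj =>
    abs_error_le_abs hA hlam hb' hFS hβ hM hz fun h => hj (hFK h)
  have hvS : ∀ j ∉ S, v j = 0 := fun j hj => by
    have := hvK j fun h => hj (hKS h)
    rwa [hβ j hj, abs_zero, abs_nonpos_iff] at this
  have hl1 : ∑ l, |v l| ≤ Real.sqrt S.card * ‖v‖ := by
    have h1 : ∑ l, |v l| = ∑ l ∈ S, |v l| := by
      refine (Finset.sum_subset (Finset.subset_univ S) fun l _ hl => ?_).symm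
      rw [hvS l hl, abs_zero]
    have h2 : (∑ l ∈ S, |v l|) ^ 2 ≤ S.card * ∑ l ∈ S, |v l| ^ 2 := sq_sum_le_card_mul_sum_sq
    rw [h1, EuclideanSpace.norm_eq, ← Real.sqrt_mul (Nat.cast_nonneg _)]
    refine Real.le_sqrt_of_sq_le (h2.trans ?_)
    gcongr
    simp only [Real.norm_eq_abs]
    exact Finset.sum_le_sum_of_subset_of_nonneg (Finset.subset_univ S) fun _ _ _ => sq_nonneg _
  have hnorm := norm_le_sum_of_subset hQK v z
  have hbias : Real.sqrt (∑ j ∈ Q, (v j - z j) ^ 2) ≤ 1 / 6 * ‖v‖ := by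
    have h1 : ∀ j ∈ Q, (v j - z j) ^ 2 ≤ (M * (Real.sqrt S.card * ‖v‖)) ^ 2 := fun j hj => by
      have h2 := abs_sum_gram_mul_sub_le hA v j
      rw [kkt_of_mem hA hb' β (hQF hj), abs_sub_comm] at h2
      rw [← sq_abs (v j - z j)]
      have h3 : M * ∑ l, |v l| ≤ M * (Real.sqrt S.card * ‖v‖) := by gcongr
      exact pow_le_pow_left₀ (abs_nonneg _) (h2.trans h3) 2
    refine Real.sqrt_le_iff.2 ⟨by positivity, ?_⟩
    calc ∑ j ∈ Q, (v j - z j) ^ 2 ≤ Q.card • (M * (Real.sqrt S.card * ‖v‖)) ^ 2 :=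
          Finset.sum_le_card_nsmul _ _ _ h1
      _ = Q.card * (M ^ 2 * S.card * ‖v‖ ^ 2) := by
          rw [nsmul_eq_mul, mul_pow, mul_pow, Real.sq_sqrt (Nat.cast_nonneg _)]
          ring
      _ ≤ S.card * (M ^ 2 * S.card * ‖v‖ ^ 2) := by
          have : (Q.card : ℝ) ≤ S.card := by
            exact_mod_cast Finset.card_le_card (hQK.trans hKS)
          gcongr
      _ = (M * S.card) ^ 2 * ‖v‖ ^ 2 := by ring
      _ ≤ (1 / 6) ^ 2 * ‖v‖ ^ 2 := by gcongr
      _ = _ := by ring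
  have hmid : Real.sqrt (∑ j ∈ K \ Q, v j ^ 2) ≤ Real.sqrt ((K.card : ℝ) - Q.card) * lam := by
    have h1 : ∑ j ∈ K \ Q, v j ^ 2 ≤ ((K.card : ℝ) - Q.card) * lam ^ 2 := by
      have := Finset.sum_le_card_nsmul (K \ Q) (fun j => v j ^ 2) (lam ^ 2) fun j _ => by
        simp only
        rw [← sq_abs (v j)]
        exact pow_le_pow_left₀ (abs_nonneg _) (hvj j) 2
      rwa [nsmul_eq_mul, Finset.card_sdiff_of_subset hQK,
        Nat.cast_sub (Finset.card_le_card hQK)] at this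
    calc _ ≤ Real.sqrt (((K.card : ℝ) - Q.card) * lam ^ 2) := Real.sqrt_le_sqrt h1
      _ = _ := by rw [Real.sqrt_mul' _ (sq_nonneg _), Real.sqrt_sq hlam.le]
  have htail : Real.sqrt (∑ j ∈ Kᶜ, v j ^ 2) ≤ tailNorm 2 K.card β := by
    refine le_trans (Real.sqrt_le_sqrt ?_) (sqrt_sum_compl_supp_sq_le_tailNorm lam β)
    exact Finset.sum_le_sum fun j hj => sq_le_sq.2 (hvK j (Finset.mem_compl.1 hj))
  -- Moving the bias `‖v‖ / 6` to the left produces the factor `6 / 5`.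
  linarith

/-! ### Sub-Gaussian linear and quadratic forms. -/

section Probability

variable {Ω : Type*} [MeasurableSpace Ω] {P : Measure Ω} {n : ℕ} {ε : Fin n → Ω → ℝ} {v : ℝ≥0}

theorem hasSubgaussianMGF_sum_mul (hindep : iIndepFun ε P)
    (hε : ∀ i, HasSubgaussianMGF (ε i) v P) (c : Fin n → ℝ) {w : ℝ≥0}
    (hw : (w : ℝ) = v * ∑ i, c i ^ 2) :
    HasSubgaussianMGF (fun ω => ∑ i, c i * ε i ω) w P := by
  have h := HasSubgaussianMGF.sum_of_iIndepFun (s := Finset.univ)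
    (hindep.comp (fun i => (c i * ·)) fun i => measurable_const_mul (c i))
    fun i _ => (hε i).const_mul (c i)
  have hw' : w = ∑ i, NNReal.mk (c i ^ 2) (sq_nonneg (c i)) * v := by
    apply NNReal.eq
    rw [hw, NNReal.coe_sum, Finset.mul_sum]
    exact Finset.sum_congr rfl fun i _ => mul_comm _ _
  rw [hw']
  exact h

theorem lintegral_exp_sum_mul_le (hindep : iIndepFun ε P)
    (hε : ∀ i, HasSubgaussianMGF (ε i) v P) (c : Fin n → ℝ) :
    ∫⁻ ω, ENNReal.ofReal (Real.exp (∑ i, c i * ε i ω)) ∂P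
      ≤ ENNReal.ofReal (Real.exp (v * (∑ i, c i ^ 2) / 2)) := by
  have h := hasSubgaussianMGF_sum_mul hindep hε c
    (w := v * NNReal.mk (∑ i, c i ^ 2) (Finset.sum_nonneg fun _ _ => sq_nonneg _)) rfl
  have hint := h.integrable_exp_mul 1
  have hle := h.mgf_le 1
  simp only [one_mul, mgf, one_pow, mul_one] at hint hle
  rw [← ofReal_integral_eq_lintegral_ofReal hint (ae_of_all _ fun _ => (Real.exp_pos _).le)]
  exact ENNReal.ofReal_le_ofReal hle

theorem gaussianPDFReal_mul_exp_sq (x : ℝ) :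
    gaussianPDFReal 0 1 x * Real.exp (x ^ 2 / 4)
      = (Real.sqrt (2 * Real.pi))⁻¹ * Real.exp (-(1 / 4) * x ^ 2) := by
  simp only [gaussianPDFReal, sub_zero, NNReal.coe_one, mul_one]
  rw [mul_assoc, ← Real.exp_add]
  ring_nf

theorem integrable_exp_sq_gaussianReal :
    Integrable (fun x : ℝ => Real.exp (x ^ 2 / 4)) (gaussianReal 0 1) := by
  rw [gaussianReal_of_var_ne_zero 0 one_ne_zero,
    integrable_withDensity_iff_integrable_smul' (measurable_gaussianPDF 0 1)
      (ae_of_all _ fun _ => gaussianPDF_lt_top)]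
  simp only [toReal_gaussianPDF, smul_eq_mul, gaussianPDFReal_mul_exp_sq]
  exact (integrable_exp_neg_mul_sq (by norm_num)).const_mul _

/-- The density leaves `exp (-x ^ 2 / 4)`, of integral `√(4π)`, against the normalization `√(2π)`.
-/
theorem integral_exp_sq_gaussianReal :
    ∫ x, Real.exp (x ^ 2 / 4) ∂gaussianReal 0 1 = Real.sqrt 2 := by
  rw [integral_gaussianReal_eq_integral_smul one_ne_zero]
  simp only [smul_eq_mul, gaussianPDFReal_mul_exp_sq]
  rw [integral_const_mul, integral_gaussian, ← Real.sqrt_inv, ← Real.sqrt_mul (by positivity)]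
  congr 1
  field_simp
  norm_num

variable {ι : Type*} [Fintype ι]

/-- Read from right to left, this linearizes the exponential of a square. The `lintegral` form
allows Tonelli without integrability checks. -/
theorem lintegral_exp_sum_mul_gaussianReal (w : ι → ℝ) :
    ∫⁻ g, ENNReal.ofReal (Real.exp (∑ j, g j * w j)) ∂Measure.pi (fun _ : ι => gaussianReal 0 1)
      = ENNReal.ofReal (Real.exp ((∑ j, w j ^ 2) / 2)) := by
  have hint : ∀ j : ι, Integrable (fun t : ℝ => Real.exp (t * w j)) (gaussianReal 0 1) := fun j => by
    simpa only [mul_comm] using integrable_exp_mul_gaussianReal (μ := 0) (v := 1) (w j)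
  have hval : ∀ j : ι, ∫ t, Real.exp (t * w j) ∂gaussianReal 0 1 = Real.exp (w j ^ 2 / 2) :=
    fun j => by
      have := congrFun (mgf_fun_id_gaussianReal (μ := 0) (v := 1)) (w j)
      simpa [mgf, mul_comm] using this
  simp only [Real.exp_sum, Finset.sum_div]
  rw [← ofReal_integral_eq_lintegral_ofReal (Integrable.fintype_prod hint)
    (ae_of_all _ fun _ => Finset.prod_nonneg fun _ _ => (Real.exp_pos _).le),
    integral_fintype_prod_eq_prod (fun j t => Real.exp (t * w j))]
  simp only [hval]

theorem lintegral_exp_sum_sq_gaussianReal :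
    ∫⁻ g, ENNReal.ofReal (Real.exp ((∑ j, g j ^ 2) / 4))
        ∂Measure.pi (fun _ : ι => gaussianReal 0 1)
      = ENNReal.ofReal (Real.sqrt 2 ^ Fintype.card ι) := by
  simp only [Real.exp_sum, Finset.sum_div]
  rw [← ofReal_integral_eq_lintegral_ofReal
    (Integrable.fintype_prod fun _ => integrable_exp_sq_gaussianReal)
    (ae_of_all _ fun _ => Finset.prod_nonneg fun _ _ => (Real.exp_pos _).le),
    integral_fintype_prod_eq_pow (fun t : ℝ => Real.exp (t ^ 2 / 4)),
    integral_exp_sq_gaussianReal]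

/-- Exponential moment of a quadratic form in independent sub-Gaussian variables, by decoupling with
a Gaussian vector. -/
theorem lintegral_exp_sum_sq_le [IsProbabilityMeasure P] (hmeas : ∀ i, Measurable (ε i))
    (hindep : iIndepFun ε P) (hε : ∀ i, HasSubgaussianMGF (ε i) v P) (a : ι → Fin n → ℝ)
    (ha : ∀ g : ι → ℝ, v * ∑ i, (∑ j, g j * a j i) ^ 2 ≤ (∑ j, g j ^ 2) / 2) :
    ∫⁻ ω, ENNReal.ofReal (Real.exp ((∑ j, (∑ i, a j i * ε i ω) ^ 2) / 2)) ∂P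
      ≤ ENNReal.ofReal (Real.sqrt 2 ^ Fintype.card ι) := by
  set γ := Measure.pi (fun _ : ι => gaussianReal 0 1)
  have hswap : ∀ (g : ι → ℝ) (ω : Ω),
      ∑ j, g j * ∑ i, a j i * ε i ω = ∑ i, (∑ j, g j * a j i) * ε i ω := fun g ω => by
    simp only [Finset.mul_sum, Finset.sum_mul]
    rw [Finset.sum_comm]
    exact Finset.sum_congr rfl fun _ _ => Finset.sum_congr rfl fun _ _ => by ring
  calc _ = ∫⁻ ω, ∫⁻ g, ENNReal.ofReal (Real.exp (∑ j, g j * ∑ i, a j i * ε i ω)) ∂γ ∂P := by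
        refine lintegral_congr fun ω => ?_
        rw [lintegral_exp_sum_mul_gaussianReal]
    _ = ∫⁻ g, ∫⁻ ω, ENNReal.ofReal (Real.exp (∑ j, g j * ∑ i, a j i * ε i ω)) ∂P ∂γ := by
        refine lintegral_lintegral_swap (Measurable.aemeasurable ?_)
        simp only [Function.uncurry_def]
        fun_prop
    _ ≤ ∫⁻ g, ENNReal.ofReal (Real.exp ((∑ j, g j ^ 2) / 4)) ∂γ := by
        refine lintegral_mono fun g => ?_
        simp only [hswap]
        refine (lintegral_exp_sum_mul_le hindep hε _).trans ?_
        refine ENNReal.ofReal_le_ofReal (Real.exp_le_exp.2 ?_)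
        linarith [ha g]
    _ = _ := lintegral_exp_sum_sq_gaussianReal

/-- Chernoff bound for a quadratic form in independent sub-Gaussian variables. -/
theorem measureReal_sum_sq_ge_le [IsProbabilityMeasure P] (hmeas : ∀ i, Measurable (ε i))
    (hindep : iIndepFun ε P) (hε : ∀ i, HasSubgaussianMGF (ε i) v P) (a : ι → Fin n → ℝ)
    (ha : ∀ g : ι → ℝ, v * ∑ i, (∑ j, g j * a j i) ^ 2 ≤ (∑ j, g j ^ 2) / 2) (u : ℝ) :
    P.real {ω | u ≤ ∑ j, (∑ i, a j i * ε i ω) ^ 2}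
      ≤ Real.sqrt 2 ^ Fintype.card ι * Real.exp (-(u / 2)) := by
  have hm : Measurable fun ω => ENNReal.ofReal (Real.exp ((∑ j, (∑ i, a j i * ε i ω) ^ 2) / 2)) := by
    fun_prop
  have h := mul_meas_ge_le_lintegral₀ (μ := P) hm.aemeasurable (ENNReal.ofReal (Real.exp (u / 2)))
  have hset : {ω | ENNReal.ofReal (Real.exp (u / 2))
      ≤ ENNReal.ofReal (Real.exp ((∑ j, (∑ i, a j i * ε i ω) ^ 2) / 2))}
      = {ω | u ≤ ∑ j, (∑ i, a j i * ε i ω) ^ 2} := by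
    ext ω
    simp only [Set.mem_ofPred_eq, ENNReal.ofReal_le_ofReal_iff (Real.exp_pos _).le, Real.exp_le_exp]
    constructor <;> intro h <;> linarith
  rw [hset] at h
  have h2 := ENNReal.toReal_mono ENNReal.ofReal_ne_top
    (h.trans (lintegral_exp_sum_sq_le hmeas hindep hε a ha))
  rw [ENNReal.toReal_mul, ENNReal.toReal_ofReal (Real.exp_pos _).le,
    ENNReal.toReal_ofReal (by positivity)] at h2
  rw [Real.exp_neg, ← div_eq_mul_inv, le_div_iff₀ (Real.exp_pos _), mul_comm]
  exact h2

theorem measureReal_abs_ge_le {X : Ω → ℝ} [IsProbabilityMeasure P] (hX : HasSubgaussianMGF X v P)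
    {u : ℝ} (hu : 0 ≤ u) :
    P.real {ω | u ≤ |X ω|} ≤ 2 * Real.exp (-u ^ 2 / (2 * v)) := by
  have hset : {ω | u ≤ |X ω|} ⊆ {ω | u ≤ X ω} ∪ {ω | u ≤ (-X) ω} := fun ω hω => by
    rcases le_abs.1 (show u ≤ |X ω| from hω) with h | h
    · exact Or.inl h
    · exact Or.inr h
  calc _ ≤ P.real ({ω | u ≤ X ω} ∪ {ω | u ≤ (-X) ω}) := measureReal_mono hset
    _ ≤ P.real {ω | u ≤ X ω} + P.real {ω | u ≤ (-X) ω} := measureReal_union_le _ _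
    _ ≤ _ := by linarith [hX.measure_ge_le hu, hX.neg.measure_ge_le hu]

end Probability

/-! ### Tail bounds for the scores. -/

section ScoreTails

variable {Ω : Type*} [MeasurableSpace Ω] {P : Measure Ω} {n d : ℕ}
  {x : Fin n → EuclideanSpace ℝ (Fin d)} {y : Fin n → Ω → ℝ} {σ : ℝ≥0}
  {β : EuclideanSpace ℝ (Fin d)}

theorem score_eq_sum (y : Fin n → ℝ) (j : Fin d) :
    score x y β j = ∑ i, x i j / n * (y i - inner ℝ β (x i)) := by
  rw [score, Finset.mul_sum]
  exact Finset.sum_congr rfl fun i _ => by ring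

theorem measurable_score (hy : ∀ i, Measurable (y i)) (j : Fin d) :
    Measurable fun ω => score x (fun i => y i ω) β j := by
  unfold score
  fun_prop

/-- For `n = 0` the sum is empty and the Gram matrix is zero. -/
theorem pos_of_gram_eq_one {j : Fin d} (hA : gram x j j = 1) : 0 < n := by
  rcases Nat.eq_zero_or_pos n with rfl | h
  · simp [gram] at hA
  · exact h

theorem iIndepFun_sub_inner (hindep : iIndepFun y P) :
    iIndepFun (fun i ω => y i ω - inner ℝ β (x i)) P :=
  hindep.comp (fun i t => t - inner ℝ β (x i)) fun _ => measurable_id.sub_const _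

variable [IsProbabilityMeasure P]

/-- Maximal inequality for the noise scores. -/
theorem measureReal_exists_score_ge_le (hindep : iIndepFun y P)
    (hsub : ∀ i, HasSubgaussianMGF (fun ω => y i ω - inner ℝ β (x i)) (σ ^ 2) P)
    (hA : ∀ j, gram x j j = 1) (hσ : 0 < σ) (hd : 0 < d) {δ lam : ℝ} (hδ0 : 0 < δ)
    (hlam : 0 < lam)
    (hlamσ : 12 * (σ : ℝ) * Real.sqrt (2 * Real.log (2 * (d : ℝ) / δ) / (n : ℝ)) ≤ lam) :
    P.real (⋃ j, {ω | lam / 12 ≤ |score x (fun i => y i ω) β j|}) ≤ δ := by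
  have hn : (0 : ℝ) < n := by exact_mod_cast pos_of_gram_eq_one (hA ⟨0, hd⟩)
  have hd' : (0 : ℝ) < d := by exact_mod_cast hd
  have hσ' : (0 : ℝ) < σ := hσ
  have hj : ∀ j : Fin d, P.real {ω | lam / 12 ≤ |score x (fun i => y i ω) β j|} ≤ δ / d := by
    intro j
    have hw : ((σ ^ 2 / n : ℝ≥0) : ℝ) = ((σ ^ 2 : ℝ≥0) : ℝ) * ∑ i, (x i j / (n : ℝ)) ^ 2 := by
      have h1 : (1 / (n : ℝ)) * ∑ i, x i j * x i j = 1 := by simpa [gram] using hA j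
      have h2 : ∑ i, (x i j / (n : ℝ)) ^ 2 = 1 / n * (1 / (n : ℝ) * ∑ i, x i j * x i j) := by
        simp only [Finset.mul_sum]
        exact Finset.sum_congr rfl fun i _ => by ring
      rw [h2, h1]
      push_cast
      ring
    have h := measureReal_abs_ge_le (hasSubgaussianMGF_sum_mul (iIndepFun_sub_inner hindep) hsub
      (fun i => x i j / (n : ℝ)) hw) (u := lam / 12) (by positivity)
    simp only [← score_eq_sum (x := x) (β := β)] at h
    refine h.trans ?_
    have hsq : 2 * Real.log (2 * (d : ℝ) / δ) / n ≤ (lam / (12 * σ)) ^ 2 := by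
      refine (Real.sqrt_le_left (by positivity)).1 ?_
      rw [le_div_iff₀ (by positivity)]
      linarith
    have hexp : -(lam / 12) ^ 2 / (2 * ((σ ^ 2 / n : ℝ≥0) : ℝ))
        ≤ -Real.log (2 * (d : ℝ) / δ) := by
      push_cast
      rw [div_le_iff₀ hn] at hsq
      have h3 : -(lam / 12) ^ 2 / (2 * ((σ : ℝ) ^ 2 / n)) = -((lam / (12 * σ)) ^ 2 * n / 2) := by
        field_simp
      rw [h3]
      linarith
    calc _ ≤ 2 * Real.exp (-Real.log (2 * (d : ℝ) / δ)) := by gcongr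
      _ = δ / d := by
          rw [Real.exp_neg, Real.exp_log (by positivity)]
          field_simp
  calc _ ≤ ∑ j, P.real {ω | lam / 12 ≤ |score x (fun i => y i ω) β j|} :=
        measureReal_iUnion_fintype_le _
    _ ≤ ∑ _j : Fin d, δ / d := Finset.sum_le_sum fun j _ => hj j
    _ = δ := by
        rw [Finset.sum_const, Finset.card_univ, Fintype.card_fin, nsmul_eq_mul]
        field_simp

/-- Tail bound for the `ℓ₂` norm of the noise scores on a small set of features. -/
theorem measureReal_sum_score_sq_gt_lt (hy : ∀ i, Measurable (y i)) (hindep : iIndepFun y P)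
    (hsub : ∀ i, HasSubgaussianMGF (fun ω => y i ω - inner ℝ β (x i)) (σ ^ 2) P)
    (hA : ∀ j, gram x j j = 1) (hσ : 0 < σ) (hn : 0 < n) {δ : ℝ} (hδ0 : 0 < δ) (hδ : δ < 1 / 2)
    {Q : Finset (Fin d)} (hM : coherence (gram x) * (Q.card : ℝ) ≤ 1 / 6) :
    P.real {ω | (σ : ℝ) ^ 2 * (20 * (Q.card : ℝ) / n * Real.log (1 / δ))
      < ∑ j ∈ Q, score x (fun i => y i ω) β j ^ 2} < δ := by
  rcases Q.eq_empty_or_nonempty with rfl | hQ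
  · simpa using hδ0
  have hq : (1 : ℝ) ≤ Q.card := by exact_mod_cast hQ.card_pos
  have hn' : (0 : ℝ) < n := by exact_mod_cast hn
  have hσ' : (0 : ℝ) < σ := hσ
  set L := Real.log (1 / δ) with hL
  have hL2 : Real.log 2 ≤ L := by
    refine Real.log_le_log two_pos ?_
    rw [le_div_iff₀ hδ0]
    linarith
  have hL0 : 0 < L := (Real.log_pos one_lt_two).trans_le hL2
  -- Chosen so that the factor `3/7` times the sparse eigenvalue bound `7/6` gives the `1/2` needed
  -- for decoupling. The threshold becomes `20 * 3/7 = 60/7`.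
  set t := Real.sqrt (3 / 7 * n) / σ with ht
  have ht2 : (σ : ℝ) ^ 2 * t ^ 2 = 3 / 7 * n := by
    rw [ht, div_pow, Real.sq_sqrt (by positivity)]
    field_simp
  have ha : ∀ g : Q → ℝ, ((σ ^ 2 : ℝ≥0) : ℝ) * ∑ i, (∑ j, g j * (t * (x i j / n))) ^ 2
      ≤ (∑ j, g j ^ 2) / 2 := by
    intro g
    set v : EuclideanSpace ℝ (Fin d) := WithLp.toLp 2 fun j => if h : j ∈ Q then g ⟨j, h⟩ else 0
      with hv
    have hvQ : ∀ j ∉ Q, v j = 0 := fun j hj => by simp [hv, hj]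
    have hvg : ∀ j : Q, v j = g j := fun j => by simp [hv]
    have hsum : ∀ f : Fin d → ℝ, (∀ j ∉ Q, f j = 0) → ∑ j, f j = ∑ j : Q, f j := fun f hf => by
      rw [Finset.sum_coe_sort Q f]
      exact (Finset.sum_subset (Finset.subset_univ Q) fun j _ hj => hf j hj).symm
    have hin : ∀ i, ∑ j : Q, g j * (t * (x i j / n)) = t / n * inner ℝ v (x i) := fun i => by
      have : (inner ℝ v (x i) : ℝ) = ∑ j, v j * x i j := by
        simp [PiLp.inner_apply, mul_comm]
      rw [this, hsum _ fun j hj => by rw [hvQ j hj, zero_mul], Finset.mul_sum]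
      refine Finset.sum_congr rfl fun j _ => ?_
      rw [hvg]
      ring
    have hnorm : ∑ j, v j ^ 2 = ∑ j, g j ^ 2 := by
      rw [hsum _ fun j hj => by rw [hvQ j hj]; ring]
      exact Finset.sum_congr rfl fun j _ => by rw [hvg]
    have hkey := sum_inner_sq_le_of_sparse hA hM v hvQ
    simp only [hin, mul_pow]
    rw [← Finset.mul_sum, ← hnorm]
    push_cast
    calc (σ : ℝ) ^ 2 * ((t / n) ^ 2 * ∑ i, (inner ℝ v (x i)) ^ 2)
        = (σ : ℝ) ^ 2 * t ^ 2 / n * (1 / n * ∑ i, (inner ℝ v (x i)) ^ 2) := by ring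
      _ = 3 / 7 * (1 / n * ∑ i, (inner ℝ v (x i)) ^ 2) := by
          rw [ht2, mul_div_assoc, div_self hn'.ne', mul_one]
      _ ≤ 3 / 7 * (7 / 6 * ∑ j, v j ^ 2) := by gcongr
      _ = _ := by ring
  have h := measureReal_sum_sq_ge_le (fun i => (hy i).sub_const (inner ℝ β (x i)))
    (iIndepFun_sub_inner hindep) hsub (fun (j : Q) i => t * (x i j / n)) ha
    (60 / 7 * (Q.card : ℝ) * L)
  have hscore : ∀ ω, ∑ j : Q, (∑ i, t * (x i j / n) * (y i ω - inner ℝ β (x i))) ^ 2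
      = t ^ 2 * ∑ j ∈ Q, score x (fun i => y i ω) β j ^ 2 := fun ω => by
    rw [← Finset.sum_coe_sort Q, Finset.mul_sum]
    refine Finset.sum_congr rfl fun j _ => ?_
    rw [score_eq_sum, ← mul_pow, Finset.mul_sum]
    simp only [mul_assoc]
  simp only [hscore] at h
  have hset : {ω | (σ : ℝ) ^ 2 * (20 * (Q.card : ℝ) / n * L)
      < ∑ j ∈ Q, score x (fun i => y i ω) β j ^ 2}
      ⊆ {ω | 60 / 7 * (Q.card : ℝ) * L ≤ t ^ 2 * ∑ j ∈ Q, score x (fun i => y i ω) β j ^ 2} := by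
    intro ω hω
    have h1 : (σ : ℝ) ^ 2 * (20 * (Q.card : ℝ) / n * L)
      < ∑ j ∈ Q, score x (fun i => y i ω) β j ^ 2 := hω
    have h2 : 60 / 7 * (Q.card : ℝ) * L = t ^ 2 * ((σ : ℝ) ^ 2 * (20 * (Q.card : ℝ) / n * L)) := by
      rw [← mul_assoc, mul_comm (t ^ 2), ht2]
      field_simp
      ring
    show 60 / 7 * (Q.card : ℝ) * L ≤ t ^ 2 * ∑ j ∈ Q, score x (fun i => y i ω) β j ^ 2
    rw [h2]
    gcongr
  -- Since `√2 ≤ 2 ≤ 1 / δ = exp L`, the dimension factor costs `Q.card * L` of the available `30/7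
  -- * Q.card * L`; more than `L` is left because `Q` is nonempty.
  have hs2 : Real.sqrt 2 ^ Q.card ≤ Real.exp (Q.card * L) := by
    rw [Real.exp_nat_mul]
    refine pow_le_pow_left₀ (Real.sqrt_nonneg _) ?_ _
    have h3 : (2 : ℝ) ≤ Real.exp L := by
      rw [← Real.exp_log two_pos]
      exact Real.exp_le_exp.2 hL2
    refine le_trans ?_ h3
    rw [Real.sqrt_le_left two_pos.le]
    norm_num
  calc _ ≤ _ := measureReal_mono hset
    _ ≤ _ := h
    _ ≤ Real.exp (Q.card * L) * Real.exp (-(60 / 7 * (Q.card : ℝ) * L / 2)) := by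
        rw [Fintype.card_coe]
        gcongr
    _ < Real.exp (-L) := by
        rw [← Real.exp_add, Real.exp_lt_exp]
        nlinarith
    _ = δ := by
        rw [hL, one_div, Real.log_inv, neg_neg, Real.exp_log hδ0]

end ScoreTails

/-! ### Assembling the bound. -/

theorem tailNorm_nonneg {d : ℕ} (p : ℝ) (k : ℕ) (β : EuclideanSpace ℝ (Fin d)) :
    0 ≤ tailNorm p k β :=
  Real.rpow_nonneg (Finset.sum_nonneg fun _ _ => Real.rpow_nonneg (abs_nonneg _) _) _

end TwoStageLasso

theorem corollary8p1 {Ω : Type*} [MeasurableSpace Ω] (P : Measure Ω) [IsProbabilityMeasure P]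
    {n d : ℕ} (x : Fin n → EuclideanSpace ℝ (Fin d)) (y : Fin n → Ω → ℝ) (σ : ℝ≥0)
    (hy_meas : ∀ i, Measurable (y i))
    (hy_indep : iIndepFun y P)
    (hy_subG : ∀ i, HasSubgaussianMGF (fun ω => y i ω - ∫ ω', y i ω' ∂P) (σ ^ 2) P)
    (hA : ∀ j, TwoStageLasso.gram x j j = 1)
    (βbar : EuclideanSpace ℝ (Fin d))
    (hmean : ∀ i, ∫ ω, y i ω ∂P = inner ℝ βbar (x i))
    (s : ℕ) (hs : (TwoStageLasso.supp 0 βbar).card ≤ s)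
    (hsd : (s : ℝ) ≤ (d : ℝ) / 3)
    (hM : TwoStageLasso.coherence (TwoStageLasso.gram x) * (s : ℝ) ≤ 1 / 6)
    (δ : ℝ) (hδ0 : 0 < δ) (hδ : δ < 1 / 2)
    (lam α : ℝ) (hlam : 0 < lam)
    (hlamα : lam ≤ α / 48)
    (hlamσ : 12 * (σ : ℝ) * Real.sqrt (2 * Real.log (2 * (d : ℝ) / δ) / (n : ℝ)) ≤ lam)
    (k q : ℕ) (hk : k = (TwoStageLasso.supp lam βbar).card)
    (hq : q = (TwoStageLasso.supp (1.5 * α) βbar).card) :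
    ∃ E : Set Ω, MeasurableSet E ∧ 1 - 2 * δ < P.real E ∧
      ∀ ω ∈ E, ∀ b' : EuclideanSpace ℝ (Fin d),
        TwoStageLasso.IsTwoStage x (fun i => y i ω) lam α b' →
        ‖b' - βbar‖ ≤ 24 * Real.sqrt ((k : ℝ) - (q : ℝ)) * lam
          + 24 * (σ : ℝ) * (1 + Real.sqrt (20 * (q : ℝ) / (n : ℝ) * Real.log (1 / δ)))
          + 168 * TwoStageLasso.tailNorm 2 k βbar := by
  have hα : 0 < α := by linarith
  have hSs : ((TwoStageLasso.supp 0 βbar).card : ℝ) ≤ s := by exact_mod_cast hs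
  have hMS : TwoStageLasso.coherence (TwoStageLasso.gram x)
      * ((TwoStageLasso.supp 0 βbar).card : ℝ) ≤ 1 / 6 :=
    (mul_le_mul_of_nonneg_left hSs (TwoStageLasso.coherence_nonneg _)).trans hM
  have hQS : TwoStageLasso.supp (1.5 * α) βbar ⊆ TwoStageLasso.supp 0 βbar := fun j hj => by
    simp only [TwoStageLasso.supp, Finset.mem_filter, Finset.mem_univ, true_and] at hj ⊢
    linarith
  have hMQ : TwoStageLasso.coherence (TwoStageLasso.gram x)
      * ((TwoStageLasso.supp (1.5 * α) βbar).card : ℝ) ≤ 1 / 6 :=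
    (mul_le_mul_of_nonneg_left (by exact_mod_cast Finset.card_le_card hQS)
      (TwoStageLasso.coherence_nonneg _)).trans hMS
  have htail := TwoStageLasso.tailNorm_nonneg 2 k βbar
  have hdet : ∀ ω, (∀ j, |TwoStageLasso.score x (fun i => y i ω) βbar j| ≤ lam / 12) →
      ∑ j ∈ TwoStageLasso.supp (1.5 * α) βbar,
        TwoStageLasso.score x (fun i => y i ω) βbar j ^ 2
        ≤ (σ : ℝ) ^ 2 * (20 * (q : ℝ) / n * Real.log (1 / δ)) →
      ∀ b' : EuclideanSpace ℝ (Fin d), TwoStageLasso.IsTwoStage x (fun i => y i ω) lam α b' →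
        ‖b' - βbar‖ ≤ 24 * Real.sqrt ((k : ℝ) - (q : ℝ)) * lam
          + 24 * (σ : ℝ) * (1 + Real.sqrt (20 * (q : ℝ) / (n : ℝ) * Real.log (1 / δ)))
          + 168 * TwoStageLasso.tailNorm 2 k βbar := by
    intro ω hz hsum b' hb'
    have h := TwoStageLasso.norm_error_le_of_isTwoStage hA hlam hlamα hMS hz hb'
    rw [← hk, ← hq] at h
    have hnoise := Real.sqrt_le_sqrt hsum
    rw [Real.sqrt_mul (sq_nonneg _), Real.sqrt_sq σ.coe_nonneg] at hnoise
    have h1 : 0 ≤ Real.sqrt ((k : ℝ) - q) * lam := by positivity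
    have h2 : 0 ≤ (σ : ℝ) * Real.sqrt (20 * (q : ℝ) / (n : ℝ) * Real.log (1 / δ)) := by positivity
    -- The factor `6 / 5` is far below `24` and `168`, and the lone `24 σ` is pure slack.
    linarith [σ.coe_nonneg]
  rcases Nat.eq_zero_or_pos d with rfl | hd
  · refine ⟨Set.univ, MeasurableSet.univ, by simp [hδ0], fun ω _ b' _ => ?_⟩
    rw [Subsingleton.elim b' βbar, sub_self, norm_zero]
    positivity
  have hn : 0 < n := TwoStageLasso.pos_of_gram_eq_one (hA ⟨0, hd⟩)
  have hsub : ∀ i, HasSubgaussianMGF (fun ω => y i ω - inner ℝ βbar (x i)) (σ ^ 2) P := fun i => by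
    simpa only [hmean i] using hy_subG i
  -- The tail bounds divide by `σ`; for `σ = 0` the noise and all scores vanish almost surely.
  rcases eq_or_lt_of_le (zero_le : 0 ≤ σ) with hσ | hσ
  · have hm : MeasurableSet (⋂ i, {ω | y i ω = inner ℝ βbar (x i)}) := MeasurableSet.iInter fun i =>
      measurableSet_eq_fun (hy_meas i) measurable_const
    refine ⟨_, hm, ?_, fun ω hω => ?_⟩
    · have hae : ∀ᵐ ω ∂P, ω ∈ ⋂ i, {ω | y i ω = inner ℝ βbar (x i)} := by
        simp only [Set.mem_iInter]
        refine ae_all_iff.2 fun i => ?_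
        have h0 := hsub i
        rw [← hσ, zero_pow two_ne_zero] at h0
        filter_upwards [h0.ae_eq_zero_of_hasSubgaussianMGF_zero] with ω hω
        exact sub_eq_zero.1 hω
      rw [measureReal_def, (mem_ae_iff_prob_eq_one hm).1 hae]
      simp [hδ0]
    · have hz : ∀ j, TwoStageLasso.score x (fun i => y i ω) βbar j = 0 := fun j => by
        have h0 : ∀ i, y i ω = inner ℝ βbar (x i) := fun i => Set.mem_iInter.1 hω i
        simp [TwoStageLasso.score, h0]
      refine hdet ω (fun j => ?_) ?_
      · rw [hz, abs_zero]
        positivity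
      · simp [hz, ← hσ]
  · have hmz := TwoStageLasso.measurable_score (x := x) (β := βbar) hy_meas
    set B₁ := ⋃ j, {ω | lam / 12 ≤ |TwoStageLasso.score x (fun i => y i ω) βbar j|} with hB₁
    set B₂ := {ω | (σ : ℝ) ^ 2 * (20 * (q : ℝ) / n * Real.log (1 / δ))
      < ∑ j ∈ TwoStageLasso.supp (1.5 * α) βbar,
        TwoStageLasso.score x (fun i => y i ω) βbar j ^ 2} with hB₂
    have hm₁ : MeasurableSet B₁ := MeasurableSet.iUnion fun j =>
      measurableSet_le measurable_const (hmz j).abs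
    have hm₂ : MeasurableSet B₂ := measurableSet_lt measurable_const
      (Finset.measurable_fun_sum _ fun j _ => (hmz j).pow_const 2)
    have hp₁ : P.real B₁ ≤ δ :=
      TwoStageLasso.measureReal_exists_score_ge_le hy_indep hsub hA hσ hd hδ0 hlam hlamσ
    have hp₂ : P.real B₂ < δ := by
      have := TwoStageLasso.measureReal_sum_score_sq_gt_lt hy_meas hy_indep hsub hA hσ hn hδ0 hδ hMQ
      rwa [← hq] at this
    refine ⟨(B₁ ∪ B₂)ᶜ, (hm₁.union hm₂).compl, ?_, fun ω hω => ?_⟩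
    · rw [probReal_compl_eq_one_sub (hm₁.union hm₂)]
      linarith [measureReal_union_le (μ := P) B₁ B₂]
    · rw [Set.mem_compl_iff, Set.mem_union, not_or] at hω
      refine hdet ω (fun j => ?_) (not_lt.1 hω.2)
      by_contra! hlt
      exact hω.1 (Set.mem_iUnion.2 ⟨j, hlt.le⟩)
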